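/- **Theorem 1 (Convergence with known network size).** Let $\mathcal G=(\mathcal V,\mathcal E)$, $\mathcal V=\{1,\dots,N\}$, be a directed graph without self-loops in which every node has at least one outgoing link. Let $D_i\ge 1$ be the out-degree of node $i$, and let $W\in\mathbb R^{N\times N}$ be the hyperlink matrix, $w_{ij}=1/D_j$ if $(j,i)\in\mathcal E$ and $w_{ij}=0$ otherwise. Fix $m\in(0,1)$, put $M=(1-m)W+\frac mN\mathbf 1\mathbf 1^T$, and let the PageRank vector be the solution $x\in\mathbb R^N$ of $x=Mx$, $\mathbf 1^Tx=1$. Let $H_i=e_i-(1-m)W_i$, where $e_i$ and $W_i$ are the $i$-th rows of the identity matrix and of $W$, and let $y_i=m/N$. Fix $\omega\in[0,1]$, and let $s(0),s(1),\dots$ be a Markov chain on $\mathcal V$, with arbitrary initial distribution and with transition matrix $P=(1-\omega)P^W+\frac{\omega}{N}\mathbf 1\mathbf 1^T$, where $P^W$ is the Metropolis–Hastings matrix $$P^W_{ij}=\begin{cases}\min\{\frac1{D_i+1},\frac1{D_j+1}\}&\text{if }(i,j)\in\mathcal E,\\ 1-\sum_{(i,k)\in\mathcal E}P^W_{ik}&\text{if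 }i=j,\\ 0&\text{otherwise.}\end{cases}$$ If $\omega=0$, assume that $\mathcal G$ is strongly connected. Let $x(0)=0$ and $$x(k+1)=x(k)+\tfrac1N H_{s(k)}^T\bigl(y_{s(k)}-H_{s(k)}x(k)\bigr),\qquad k\ge 0.$$ Then the PageRank vector $x$ exists and is unique, and the following hold. (a) There exist (deterministic) $M_1>0$ and $\rho_1\in(0,1)$ such that, with probability one, there is a $k_0>0$ (depending on the realization) with $\|x(k)-x\|_2\le M_1\rho_1^k$ for all $k>k_0$. (b) For every $p\in[1,2]$ there exist $M_2>0$ and $\rho_2\in(0,1)$ such that $\|x(k)-x\|_{L^p}\le M_2\rho_2^k$ for all $k>0$, where $\|v\|_{L^p}=\bigl(\mathbb E\sum_{i=1}^N|v_i|^p\bigr)^{1/p}$ for a random vector $v$. -/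

import Mathlib

open scoped ENNReal

noncomputable section

namespace PageRank

variable {N : ℕ}

/-- Out-degree `D_i`: the number of links leaving node `i`. -/
def outDeg (G : Digraph (Fin N)) [DecidableRel G.Adj] (i : Fin N) : ℕ :=
  (Finset.univ.filter fun j => G.Adj i j).card

/-- Every node is reachable from every other one along a forward path. -/
def StronglyConnected (G : Digraph (Fin N)) : Prop :=
  ∀ i j : Fin N, i ≠ j → Relation.TransGen G.Adj i j

/-- The hyperlink matrix: `W i j = 1 / D_j` if `j` links to `i`, and `0` otherwise. -/
def hyperlink (G : Digraph (Fin N)) [DecidableRel G.Adj] : Matrix (Fin N) (Fin N) ℝ :=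
  Matrix.of fun i j => if G.Adj j i then 1 / (outDeg G j : ℝ) else 0

/-- The all-ones matrix `1 1ᵀ`. -/
def onesMat (N : ℕ) : Matrix (Fin N) (Fin N) ℝ := Matrix.of fun _ _ => 1

/-- The modified hyperlink matrix `M = (1 - m) W + (m / N) 1 1ᵀ`. -/
def modHyperlink (G : Digraph (Fin N)) [DecidableRel G.Adj] (m : ℝ) :
    Matrix (Fin N) (Fin N) ℝ :=
  (1 - m) • hyperlink G + (m / N) • onesMat N

/-- The PageRank equation `x = M x`, `1ᵀ x = 1`. -/
def IsPageRank (G : Digraph (Fin N)) [DecidableRel G.Adj] (m : ℝ) (x : Fin N → ℝ) : Prop :=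
  x = (modHyperlink G m).mulVec x ∧ ∑ i, x i = 1

/-- The regression row `H_i = e_i - (1 - m) W_i`. -/
def regRow (G : Digraph (Fin N)) [DecidableRel G.Adj] (m : ℝ) (i : Fin N) : Fin N → ℝ :=
  Pi.single i 1 - (1 - m) • (hyperlink G).row i

/-- The iterates driven by a node sequence `σ`: `x(0) = 0` and
`x(k+1) = x(k) + (1/N) H_{σ(k)}ᵀ (y_{σ(k)} - H_{σ(k)} x(k))`, with `y_i = m / N` for all `i`. -/
def iter (G : Digraph (Fin N)) [DecidableRel G.Adj] (m : ℝ) (σ : ℕ → Fin N) :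
    ℕ → Fin N → ℝ
  | 0 => 0
  | k + 1 => iter G m σ k +
      ((1 / (N : ℝ)) * (m / N - regRow G m (σ k) ⬝ᵥ iter G m σ k)) • regRow G m (σ k)

/-- Off-diagonal Metropolis–Hastings weights `min {1/(D_i+1), 1/(D_j+1)}` on the links `i → j`. -/
def linkWeight (G : Digraph (Fin N)) [DecidableRel G.Adj] (i j : Fin N) : ℝ :=
  if G.Adj i j then min (1 / ((outDeg G i : ℝ) + 1)) (1 / ((outDeg G j : ℝ) + 1)) else 0

/-- The Metropolis–Hastings matrix `P^W` (of a graph without self-loops). -/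
def metropolis (G : Digraph (Fin N)) [DecidableRel G.Adj] : Matrix (Fin N) (Fin N) ℝ :=
  Matrix.of fun i j => if i = j then 1 - ∑ k, linkWeight G i k else linkWeight G i j

/-- The transition matrix `P = (1 - w) P^W + (w / N) 1 1ᵀ`. -/
def transMat (G : Digraph (Fin N)) [DecidableRel G.Adj] (w : ℝ) :
    Matrix (Fin N) (Fin N) ℝ :=
  (1 - w) • metropolis G + (w / N) • onesMat N

/-- `s` is a (time-homogeneous) Markov chain on `Fin N` with transition matrix `P` and arbitrary
initial law:
`ℙ(s₀ = i₀, …, s_{k+1} = i_{k+1}) = ℙ(s₀ = i₀, …, s_k = i_k) · P_{i_k, i_{k+1}}`. -/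
structure IsMarkovChain {Ω : Type*} [MeasurableSpace Ω] (μ : MeasureTheory.Measure Ω)
    (P : Matrix (Fin N) (Fin N) ℝ) (s : ℕ → Ω → Fin N) : Prop where
  measurable : ∀ k, Measurable (s k)
  transition : ∀ (k : ℕ) (i : ℕ → Fin N),
    μ.real {a | ∀ t ≤ k + 1, s t a = i t} =
      μ.real {a | ∀ t ≤ k, s t a = i t} * P (i k) (i (k + 1))

end PageRank

end

/-! Since `x` solves `H x = y`, the error `x(k) - x` evolves linearly: at state `i` it is multiplied
by `I - (1/N) H_iᵀ H_i`. As `|H_i|² ≤ N`, no step lengthens it, and a step with `H_i v ≠ 0` shortens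
it strictly.

Let `energy` be the expected squared error after `n` steps, as a function of the starting state and
error. `W` is column stochastic, so `v = (1 - m) W v` forces `v = 0`; hence every `v ≠ 0` has `H_j v
≠ 0` for some `j`, and irreducibility takes the chain to `j` with positive probability
(`exists_energy_lt`). Compactness of the unit sphere, homogeneity and monotonicity in `n` turn this
into one contraction factor over a fixed number of steps (`exists_energy_le`), and iteration gives
geometric decay (`exists_energy_le_pow`). Neither aperiodicity nor a stationary law is needed.

The Markov property identifies the mean square error with an averaged energy
(`integral_energy_iter`). Chebyshev's inequality and Borel–Cantelli give (a); comparison of `L^p`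
with `L²` gives (b). -/

namespace PageRank

/-- The relaxed Kaczmarz step `v ↦ v - (1/N) (h · v) h` on the error vector. -/
noncomputable def errorStep {N : ℕ} (h v : Fin N → ℝ) : Fin N → ℝ :=
  v - ((1 / (N : ℝ)) * (h ⬝ᵥ v)) • h

/-- Expected squared length of the error after `n` steps, for a chain with transition matrix `P`
started at the state `i` and the error `v`, where the state `i` applies `errorStep (h i)`. -/
noncomputable def energy {N : ℕ} (P : Matrix (Fin N) (Fin N) ℝ) (h : Fin N → Fin N → ℝ) :
    ℕ → Fin N → (Fin N → ℝ) → ℝ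
  | 0, _, v => v ⬝ᵥ v
  | n + 1, i, v => ∑ j, P i j * energy P h n j (errorStep (h i) v)

/-! ### One relaxed Kaczmarz step -/

section ErrorStep

variable {N : ℕ} {h v : Fin N → ℝ}

lemma errorStep_smul (c : ℝ) : errorStep h (c • v) = c • errorStep h v := by
  simp only [errorStep, dotProduct_smul, smul_sub, smul_smul, smul_eq_mul]
  congr 2
  ring

lemma continuous_errorStep (h : Fin N → ℝ) : Continuous (errorStep h) := by
  unfold errorStep dotProduct
  fun_prop

lemma errorStep_of_dotProduct_eq_zero (hv : h ⬝ᵥ v = 0) : errorStep h v = v := by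
  simp [errorStep, hv]

/-- In the expanded square the cross term contributes `-2/N` times `(h ⬝ᵥ v)²`, and the quadratic
term returns at most `1/N` times it because `h ⬝ᵥ h ≤ N`. -/
lemma errorStep_dotProduct_self_le (hN : 0 < N) (hh : h ⬝ᵥ h ≤ N) :
    errorStep h v ⬝ᵥ errorStep h v ≤ v ⬝ᵥ v - (1 / (N : ℝ)) * (h ⬝ᵥ v) ^ 2 := by
  have hN' : (0 : ℝ) < N := by exact_mod_cast hN
  have key : errorStep h v ⬝ᵥ errorStep h v =
      v ⬝ᵥ v - 2 * (1 / (N : ℝ)) * (h ⬝ᵥ v) ^ 2 + (1 / (N : ℝ)) ^ 2 * (h ⬝ᵥ v) ^ 2 * (h ⬝ᵥ h) := by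
    simp only [errorStep, sub_dotProduct, dotProduct_sub, smul_dotProduct, dotProduct_smul,
      smul_eq_mul, dotProduct_comm v h]
    ring
  have h1 : (1 / (N : ℝ)) ^ 2 * (h ⬝ᵥ v) ^ 2 * (h ⬝ᵥ h) ≤
      (1 / (N : ℝ)) ^ 2 * (h ⬝ᵥ v) ^ 2 * N := by gcongr
  have h2 : (1 / (N : ℝ)) ^ 2 * (h ⬝ᵥ v) ^ 2 * N = (1 / (N : ℝ)) * (h ⬝ᵥ v) ^ 2 := by
    field_simp
  linarith

lemma errorStep_dotProduct_self_le_self (hN : 0 < N) (hh : h ⬝ᵥ h ≤ N) :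
    errorStep h v ⬝ᵥ errorStep h v ≤ v ⬝ᵥ v := by
  have := errorStep_dotProduct_self_le (v := v) hN hh
  have : 0 ≤ (1 / (N : ℝ)) * (h ⬝ᵥ v) ^ 2 := by positivity
  linarith

lemma errorStep_dotProduct_self_lt_self (hN : 0 < N) (hh : h ⬝ᵥ h ≤ N) (hv : h ⬝ᵥ v ≠ 0) :
    errorStep h v ⬝ᵥ errorStep h v < v ⬝ᵥ v := by
  have := errorStep_dotProduct_self_le (v := v) hN hh
  have hN' : (0 : ℝ) < N := by exact_mod_cast hN
  have : 0 < (1 / (N : ℝ)) * (h ⬝ᵥ v) ^ 2 := by positivity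
  linarith

end ErrorStep

/-! ### Contraction of the expected squared error -/

section Energy

variable {N : ℕ} {P : Matrix (Fin N) (Fin N) ℝ} {h : Fin N → Fin N → ℝ}

lemma energy_smul (c : ℝ) (n : ℕ) (i : Fin N) (v : Fin N → ℝ) :
    energy P h n i (c • v) = c ^ 2 * energy P h n i v := by
  induction n generalizing i v with
  | zero =>
    simp only [energy, dotProduct_smul, smul_dotProduct, smul_eq_mul]
    ring
  | succ n ih =>
    simp only [energy, errorStep_smul, ih, Finset.mul_sum]
    exact Finset.sum_congr rfl fun j _ => by ring

lemma continuous_energy (n : ℕ) (i : Fin N) : Continuous (energy P h n i) := by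
  induction n generalizing i with
  | zero =>
    simp only [energy, dotProduct]
    fun_prop
  | succ n ih =>
    simp only [energy]
    exact continuous_finsetSum _ fun j _ =>
      continuous_const.mul ((ih j).comp (continuous_errorStep _))

/-- The extra step is taken at the end of each path, so the induction comes down to nonexpansiveness
of a single step. -/
lemma energy_antitone (hN : 0 < N) (hh : ∀ i, h i ⬝ᵥ h i ≤ N) (hP : ∀ i j, 0 ≤ P i j)
    (hP1 : ∀ i, ∑ j, P i j = 1) (i : Fin N) (v : Fin N → ℝ) :
    Antitone fun n => energy P h n i v := by
  refine antitone_nat_of_succ_le fun n => ?_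
  induction n generalizing i v with
  | zero =>
    simp only [energy, ← Finset.sum_mul, hP1, one_mul]
    exact errorStep_dotProduct_self_le_self hN (hh i)
  | succ n ih =>
    simp only [energy] at ih ⊢
    exact Finset.sum_le_sum fun j _ => mul_le_mul_of_nonneg_left (ih j _) (hP i j)

/-- Markov property in recursive form: the uniform bound for `b` steps is applied at the state and
error reached after `a` steps. -/
lemma energy_add_le (hP : ∀ i j, 0 ≤ P i j) {b : ℕ} {c : ℝ}
    (hb : ∀ i v, energy P h b i v ≤ c * (v ⬝ᵥ v)) (a : ℕ) (i : Fin N) (v : Fin N → ℝ) :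
    energy P h (a + b) i v ≤ c * energy P h a i v := by
  induction a generalizing i v with
  | zero => simpa [energy] using hb i v
  | succ a ih =>
    rw [Nat.add_right_comm]
    simp only [energy, Finset.mul_sum]
    refine Finset.sum_le_sum fun j _ => ?_
    calc P i j * energy P h (a + b) j (errorStep (h i) v)
        ≤ P i j * (c * energy P h a j (errorStep (h i) v)) :=
          mul_le_mul_of_nonneg_left (ih j _) (hP i j)
      _ = _ := by ring

lemma energy_mul_le (hP : ∀ i j, 0 ≤ P i j) {L : ℕ} {q : ℝ} (hq : 0 ≤ q)
    (hL : ∀ i v, energy P h L i v ≤ q * (v ⬝ᵥ v)) (n : ℕ) (i : Fin N) (v : Fin N → ℝ) :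
    energy P h (L * n) i v ≤ q ^ n * (v ⬝ᵥ v) := by
  induction n with
  | zero => simp [energy]
  | succ n ih =>
    calc energy P h (L * n + L) i v ≤ q * energy P h (L * n) i v := energy_add_le hP hL _ i v
      _ ≤ q * (q ^ n * (v ⬝ᵥ v)) := by gcongr
      _ = _ := by ring

/-- If some state reachable from `i` sees the error `v`, the energy strictly decreases. -/
lemma exists_energy_lt (hN : 0 < N) (hh : ∀ i, h i ⬝ᵥ h i ≤ N) (hP : ∀ i j, 0 ≤ P i j)
    (hP1 : ∀ i, ∑ j, P i j = 1) {i j : Fin N} {v : Fin N → ℝ}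
    (hij : Relation.ReflTransGen (fun a b => 0 < P a b) i j) (hv : h j ⬝ᵥ v ≠ 0) :
    ∃ n, energy P h n i v < v ⬝ᵥ v := by
  have one_step : ∀ a, h a ⬝ᵥ v ≠ 0 → ∃ n, energy P h n a v < v ⬝ᵥ v := fun a ha => by
    refine ⟨1, ?_⟩
    simp only [energy, ← Finset.sum_mul, hP1, one_mul]
    exact errorStep_dotProduct_self_lt_self hN (hh a) ha
  induction hij using Relation.ReflTransGen.head_induction_on with
  | refl => exact one_step j hv
  | @head a c hac _ ih =>
    -- If `a` does not see `v`, the error reaches all successors unchanged: none gains energy, and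
    -- `c`, which has positive weight, loses some. Otherwise the step at `a` already shortens it.
    by_cases ha : h a ⬝ᵥ v = 0
    · obtain ⟨n, hn⟩ := ih
      refine ⟨n + 1, ?_⟩
      simp only [energy, errorStep_of_dotProduct_eq_zero ha]
      calc ∑ b, P a b * energy P h n b v < ∑ b, P a b * (v ⬝ᵥ v) :=
            Finset.sum_lt_sum (fun b _ => mul_le_mul_of_nonneg_left
              (energy_antitone hN hh hP hP1 b v (Nat.zero_le n)) (hP a b))
              ⟨c, Finset.mem_univ c, mul_lt_mul_of_pos_left hn hac⟩
        _ = v ⬝ᵥ v := by rw [← Finset.sum_mul, hP1, one_mul]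
    · exact one_step a ha

lemma isCompact_dotProduct_self_eq_one : IsCompact {v : Fin N → ℝ | v ⬝ᵥ v = 1} := by
  refine Metric.isCompact_of_isClosed_isBounded ?_ ?_
  · refine isClosed_eq ?_ continuous_const
    unfold dotProduct
    fun_prop
  · refine (Metric.isBounded_closedBall (x := 0) (r := 1)).subset fun v hv => ?_
    rw [mem_closedBall_zero_iff, pi_norm_le_iff_of_nonneg zero_le_one]
    intro i
    have h1 : v i * v i ≤ v ⬝ᵥ v :=
      Finset.single_le_sum (f := fun i => v i * v i) (fun j _ => mul_self_nonneg _)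
        (Finset.mem_univ i)
    rw [Set.mem_ofPred_eq.mp hv] at h1
    rw [Real.norm_eq_abs]
    exact abs_le_one_iff_mul_self_le_one.mpr h1

/-- The open sets `energy n < 1` increase with `n` and cover the compact product of states and unit
sphere, so a single `n` suffices. The maximum there is below `1`, and quadratic homogeneity extends
the bound to all errors. -/
lemma exists_energy_le (hN : 0 < N) (hh : ∀ i, h i ⬝ᵥ h i ≤ N) (hP : ∀ i j, 0 ≤ P i j)
    (hP1 : ∀ i, ∑ j, P i j = 1)
    (hirr : ∀ i j, Relation.ReflTransGen (fun a b => 0 < P a b) i j)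
    (hinj : ∀ v : Fin N → ℝ, (∀ i, h i ⬝ᵥ v = 0) → v = 0) :
    ∃ L, 0 < L ∧ ∃ q ∈ Set.Ioo (0 : ℝ) 1, ∀ i v, energy P h L i v ≤ q * (v ⬝ᵥ v) := by
  have hK : IsCompact ((Set.univ : Set (Fin N)) ×ˢ {v : Fin N → ℝ | v ⬝ᵥ v = 1}) :=
    isCompact_univ.prod isCompact_dotProduct_self_eq_one
  have hcont : ∀ n, Continuous fun z : Fin N × (Fin N → ℝ) => energy P h n z.1 z.2 := fun n =>
    continuous_prod_of_discrete_left.mpr fun i => continuous_energy n i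
  obtain ⟨L, hL⟩ := hK.elim_directed_cover
    (fun n => {z : Fin N × (Fin N → ℝ) | energy P h n z.1 z.2 < 1})
    (fun n => isOpen_lt (hcont n) continuous_const)
    (by
      rintro ⟨i, v⟩ ⟨-, hv⟩
      rw [Set.mem_ofPred_eq] at hv
      have hv0 : v ≠ 0 := by
        rintro rfl
        simp at hv
      obtain ⟨j, hj⟩ : ∃ j, h j ⬝ᵥ v ≠ 0 := by
        by_contra! hcon
        exact hv0 (hinj v hcon)
      obtain ⟨n, hn⟩ := exists_energy_lt hN hh hP hP1 (hirr i j) hj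
      exact Set.mem_iUnion.mpr ⟨n, by simpa [hv] using hn⟩)
    (directed_of_isDirected_le fun a b hab z hz =>
      (energy_antitone hN hh hP hP1 z.1 z.2 hab).trans_lt hz)
  obtain ⟨q, hq1, hq⟩ : ∃ q < (1 : ℝ), ∀ i (v : Fin N → ℝ), v ⬝ᵥ v = 1 → energy P h L i v ≤ q := by
    rcases Set.eq_empty_or_nonempty
      ((Set.univ : Set (Fin N)) ×ˢ {v : Fin N → ℝ | v ⬝ᵥ v = 1}) with he | hne
    · refine ⟨0, zero_lt_one, fun i v hv => ?_⟩
      exact absurd (he ▸ Set.mk_mem_prod (Set.mem_univ i) hv : (i, v) ∈ (∅ : Set _)) (by simp)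
    · obtain ⟨z, hz, hmax⟩ := hK.exists_isMaxOn hne (hcont L).continuousOn
      exact ⟨_, hL hz, fun i v hv => hmax (Set.mk_mem_prod (Set.mem_univ i) hv)⟩
  -- `L + 1` makes the block length positive and the maximum with `1/2` makes the factor positive,
  -- so that its `L`-th root and inverse can be used later.
  refine ⟨L + 1, L.succ_pos, max q (1 / 2), ⟨by positivity, max_lt hq1 (by norm_num)⟩,
    fun i v => (energy_antitone hN hh hP hP1 i v L.le_succ).trans ?_⟩
  by_cases hv : v = 0
  · subst hv
    simpa using (energy_smul 0 L i (0 : Fin N → ℝ) (P := P) (h := h)).le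
  have hpos : 0 < v ⬝ᵥ v := lt_of_le_of_ne
    (Finset.sum_nonneg fun i _ => mul_self_nonneg _)
    (fun h0 => hv (dotProduct_self_eq_zero.mp h0.symm))
  set c := √(v ⬝ᵥ v) with hc
  have hc2 : c ^ 2 = v ⬝ᵥ v := Real.sq_sqrt hpos.le
  have hc0 : c ≠ 0 := (Real.sqrt_pos.mpr hpos).ne'
  have hunit : (c⁻¹ • v) ⬝ᵥ (c⁻¹ • v) = 1 := by
    simp only [dotProduct_smul, smul_dotProduct, smul_eq_mul, ← hc2]
    field_simp
  have hscale : energy P h L i v = c ^ 2 * energy P h L i (c⁻¹ • v) := by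
    rw [← energy_smul, smul_inv_smul₀ hc0]
  simp only [hscale, ← hc2]
  rw [mul_comm]
  exact mul_le_mul_of_nonneg_right ((hq i _ hunit).trans (le_max_left _ _)) (sq_nonneg c)

/-- Exponential decay of the expected squared error. -/
lemma exists_energy_le_pow (hN : 0 < N) (hh : ∀ i, h i ⬝ᵥ h i ≤ N) (hP : ∀ i j, 0 ≤ P i j)
    (hP1 : ∀ i, ∑ j, P i j = 1)
    (hirr : ∀ i j, Relation.ReflTransGen (fun a b => 0 < P a b) i j)
    (hinj : ∀ v : Fin N → ℝ, (∀ i, h i ⬝ᵥ v = 0) → v = 0) :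
    ∃ C > (0 : ℝ), ∃ r ∈ Set.Ioo (0 : ℝ) 1, ∀ k i v, energy P h k i v ≤ C * r ^ k * (v ⬝ᵥ v) := by
  obtain ⟨L, hL0, q, ⟨hq0, hq1⟩, hL⟩ := exists_energy_le hN hh hP hP1 hirr hinj
  have hr1 : q ^ ((1 : ℝ) / L) < 1 := Real.rpow_lt_one hq0.le hq1 (by positivity)
  have hr0 : 0 < q ^ ((1 : ℝ) / L) := Real.rpow_pos_of_pos hq0 _
  have hrL : (q ^ ((1 : ℝ) / L)) ^ L = q := by
    rw [one_div, Real.rpow_inv_natCast_pow hq0.le hL0.ne']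
  generalize q ^ ((1 : ℝ) / L) = r at hr0 hr1 hrL
  -- With `r ^ L = q`, the factor `q⁻¹` pays for the incomplete last block of length `k % L`.
  refine ⟨q⁻¹, inv_pos.mpr hq0, r, ⟨hr0, hr1⟩, fun k i v => ?_⟩
  have hv : 0 ≤ v ⬝ᵥ v := Finset.sum_nonneg fun i _ => mul_self_nonneg _
  calc energy P h k i v ≤ energy P h (L * (k / L)) i v :=
        energy_antitone hN hh hP hP1 i v (Nat.mul_div_le k L)
    _ ≤ q ^ (k / L) * (v ⬝ᵥ v) := energy_mul_le hP hq0.le hL _ i v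
    _ ≤ q⁻¹ * r ^ k * (v ⬝ᵥ v) := by
        refine mul_le_mul_of_nonneg_right ?_ hv
        rw [inv_mul_eq_div, le_div_iff₀ hq0]
        calc q ^ (k / L) * q = r ^ (L * (k / L) + L) := by rw [pow_add, pow_mul, hrL]
          _ ≤ r ^ k := pow_le_pow_of_le_one hr0.le hr1.le (Nat.lt_mul_div_succ k hL0).le

end Energy

end PageRank

/-! ### The hyperlink, PageRank and transition matrices -/

namespace PageRank

section Graph

variable {N : ℕ} (G : Digraph (Fin N)) [DecidableRel G.Adj]

lemma outDeg_pos (h_dangling : ∀ i, ∃ j, G.Adj i j) (i : Fin N) : 0 < outDeg G i := by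
  obtain ⟨j, hj⟩ := h_dangling i
  exact Finset.card_pos.mpr ⟨j, by simpa using hj⟩

lemma hyperlink_nonneg (i j : Fin N) : 0 ≤ hyperlink G i j := by
  simp only [hyperlink, Matrix.of_apply]
  split_ifs <;> positivity

lemma hyperlink_le_one (i j : Fin N) : hyperlink G i j ≤ 1 := by
  simp only [hyperlink, Matrix.of_apply]
  split_ifs
  · rw [one_div]
    exact Nat.cast_inv_le_one _
  · exact zero_le_one

lemma sum_hyperlink (h_dangling : ∀ i, ∃ j, G.Adj i j) (j : Fin N) :
    ∑ i, hyperlink G i j = 1 := by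
  have hpos : (outDeg G j : ℝ) ≠ 0 := by exact_mod_cast (outDeg_pos G h_dangling j).ne'
  simp only [hyperlink, Matrix.of_apply]
  rw [← Finset.sum_filter, Finset.sum_const, nsmul_eq_mul]
  exact mul_one_div_cancel hpos

lemma regRow_dotProduct (m : ℝ) (i : Fin N) (v : Fin N → ℝ) :
    regRow G m i ⬝ᵥ v = v i - (1 - m) * (hyperlink G).mulVec v i := by
  simp [regRow, sub_dotProduct, smul_dotProduct, Matrix.mulVec, Matrix.row]

/-- Without self-loops the diagonal entry is exactly `1`, and the others lie in `[-1, 0]`; all `N`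
squares are at most `1`. -/
lemma regRow_dotProduct_self_le (h_loop : ∀ i, ¬ G.Adj i i) {m : ℝ} (hm : m ∈ Set.Ioo (0 : ℝ) 1)
    (i : Fin N) : regRow G m i ⬝ᵥ regRow G m i ≤ N := by
  have hle : ∀ j, regRow G m i j * regRow G m i j ≤ 1 := fun j => by
    rw [← abs_le_one_iff_mul_self_le_one]
    simp only [regRow, Pi.sub_apply, Pi.smul_apply, Matrix.row, smul_eq_mul]
    by_cases hij : j = i
    · subst hij
      simp [hyperlink, h_loop]
    · rw [Pi.single_eq_of_ne hij, zero_sub, abs_neg, abs_of_nonneg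
        (mul_nonneg (by linarith [hm.2]) (hyperlink_nonneg G i j))]
      exact mul_le_one₀ (by linarith [hm.1]) (hyperlink_nonneg G i j) (hyperlink_le_one G i j)
  calc regRow G m i ⬝ᵥ regRow G m i ≤ ∑ _j : Fin N, (1 : ℝ) := Finset.sum_le_sum fun j _ => hle j
    _ = N := by simp

lemma sum_hyperlink_mulVec (h_dangling : ∀ i, ∃ j, G.Adj i j) (v : Fin N → ℝ) :
    ∑ i, (hyperlink G).mulVec v i = ∑ j, v j := by
  simp only [Matrix.mulVec, dotProduct]
  rw [Finset.sum_comm]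
  simp only [← Finset.sum_mul, sum_hyperlink G h_dangling, one_mul]

/-- Unit column sums make `W` nonexpansive in the `ℓ¹` norm, so `v = (1 - m) W v` gives `‖v‖₁ ≤ (1 -
m) ‖v‖₁`. -/
lemma eq_zero_of_regRow_dotProduct_eq_zero (h_dangling : ∀ i, ∃ j, G.Adj i j) {m : ℝ}
    (hm : m ∈ Set.Ioo (0 : ℝ) 1) (v : Fin N → ℝ) (hv : ∀ i, regRow G m i ⬝ᵥ v = 0) : v = 0 := by
  have hm1 : 0 ≤ 1 - m := by linarith [hm.2]
  have habs : ∀ i, |v i| ≤ (1 - m) * (hyperlink G).mulVec (fun j => |v j|) i := fun i => by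
    have := hv i
    rw [regRow_dotProduct, sub_eq_zero] at this
    rw [this, abs_mul, abs_of_nonneg hm1]
    refine mul_le_mul_of_nonneg_left ?_ hm1
    simp only [Matrix.mulVec, dotProduct]
    refine (Finset.abs_sum_le_sum_abs _ _).trans_eq ?_
    exact Finset.sum_congr rfl fun j _ => by rw [abs_mul, abs_of_nonneg (hyperlink_nonneg G i j)]
  have hsum : ∑ i, |v i| ≤ (1 - m) * ∑ i, |v i| := by
    refine (Finset.sum_le_sum fun i _ => habs i).trans_eq ?_
    rw [← Finset.mul_sum, sum_hyperlink_mulVec G h_dangling]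
  have hnn : 0 ≤ ∑ i, |v i| := Finset.sum_nonneg fun i _ => abs_nonneg _
  have h0 : ∑ i, |v i| = 0 := by nlinarith [hm.1]
  funext i
  exact abs_eq_zero.mp ((Finset.sum_eq_zero_iff_of_nonneg fun i _ => abs_nonneg _).mp h0 i
    (Finset.mem_univ i))

/-- The normalization is implicit in the linear system: summing the `N` equations gives `m ∑ x i =
m`. -/
lemma isPageRank_iff (hN : 0 < N) (h_dangling : ∀ i, ∃ j, G.Adj i j) {m : ℝ}
    (hm : m ∈ Set.Ioo (0 : ℝ) 1) (x : Fin N → ℝ) :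
    IsPageRank G m x ↔ ∀ i, regRow G m i ⬝ᵥ x = m / N := by
  have hM : ∀ i, (modHyperlink G m).mulVec x i =
      (1 - m) * (hyperlink G).mulVec x i + m / N * ∑ j, x j := fun i => by
    simp [modHyperlink, onesMat, Matrix.mulVec, dotProduct, add_mul, Finset.sum_add_distrib,
      Finset.mul_sum, mul_assoc]
  have hN' : (N : ℝ) ≠ 0 := by exact_mod_cast hN.ne'
  refine ⟨fun ⟨hx, h1⟩ i => ?_, fun hx => ?_⟩
  · have hi := congrFun hx i
    rw [hM, h1] at hi
    rw [regRow_dotProduct]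
    linarith
  · have h1 : ∑ i, x i = 1 := by
      have hs : ∑ i, regRow G m i ⬝ᵥ x = m := by
        simp only [hx, Finset.sum_const, Finset.card_univ, Fintype.card_fin, nsmul_eq_mul]
        field_simp
      simp only [regRow_dotProduct, Finset.sum_sub_distrib, ← Finset.mul_sum,
        sum_hyperlink_mulVec G h_dangling] at hs
      have : m * (∑ i, x i - 1) = 0 := by linarith
      rcases mul_eq_zero.mp this with h | h
      · exact absurd h hm.1.ne'
      · linarith
    refine ⟨funext fun i => ?_, h1⟩
    have hi := hx i
    rw [regRow_dotProduct] at hi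
    rw [hM, h1]
    linarith

lemma existsUnique_isPageRank (hN : 0 < N) (h_dangling : ∀ i, ∃ j, G.Adj i j) {m : ℝ}
    (hm : m ∈ Set.Ioo (0 : ℝ) 1) : ∃! x : Fin N → ℝ, IsPageRank G m x := by
  have hinj : Function.Injective (Matrix.mulVecLin (Matrix.of (regRow G m))) := by
    rw [← LinearMap.ker_eq_bot, LinearMap.ker_eq_bot']
    exact fun v hv => eq_zero_of_regRow_dotProduct_eq_zero G h_dangling hm v fun i => congrFun hv i
  obtain ⟨x, hx⟩ := LinearMap.injective_iff_surjective.mp hinj (fun _ => m / N)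
  refine ⟨x, (isPageRank_iff G hN h_dangling hm x).mpr fun i => congrFun hx i, fun y hy => ?_⟩
  refine hinj (hx.symm ▸ funext fun i => (isPageRank_iff G hN h_dangling hm y).mp hy i)

lemma linkWeight_nonneg (i j : Fin N) : 0 ≤ linkWeight G i j := by
  unfold linkWeight
  split_ifs <;> positivity

lemma linkWeight_pos {i j : Fin N} (hij : G.Adj i j) : 0 < linkWeight G i j := by
  rw [linkWeight, if_pos hij]
  positivity

lemma sum_linkWeight_le_one (i : Fin N) : ∑ k, linkWeight G i k ≤ 1 := by
  calc ∑ k, linkWeight G i k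
      ≤ ∑ k, if G.Adj i k then 1 / ((outDeg G i : ℝ) + 1) else 0 := by
        refine Finset.sum_le_sum fun k _ => ?_
        unfold linkWeight
        split_ifs
        · exact min_le_left _ _
        · exact le_rfl
    _ = outDeg G i / ((outDeg G i : ℝ) + 1) := by
        rw [← Finset.sum_filter, Finset.sum_const, nsmul_eq_mul, mul_one_div]
        rfl
    _ ≤ 1 := div_le_one_of_le₀ (by linarith) (by positivity)

lemma metropolis_nonneg (i j : Fin N) : 0 ≤ metropolis G i j := by
  simp only [metropolis, Matrix.of_apply]
  split_ifs
  · linarith [sum_linkWeight_le_one G i]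
  · exact linkWeight_nonneg G i j

lemma sum_metropolis (h_loop : ∀ i, ¬ G.Adj i i) (i : Fin N) : ∑ j, metropolis G i j = 1 := by
  have hii : linkWeight G i i = 0 := if_neg (h_loop i)
  have hsplit : ∀ j, metropolis G i j =
      (if i = j then 1 - ∑ k, linkWeight G i k else 0) + linkWeight G i j := fun j => by
    simp only [metropolis, Matrix.of_apply]
    split_ifs with hij
    · rw [← hij, hii, add_zero]
    · rw [zero_add]
  simp [hsplit, Finset.sum_add_distrib]

lemma transMat_apply (w : ℝ) (i j : Fin N) :
    transMat G w i j = (1 - w) * metropolis G i j + w / N := by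
  simp [transMat, onesMat]

lemma transMat_nonneg {w : ℝ} (hw : w ∈ Set.Icc (0 : ℝ) 1) (i j : Fin N) :
    0 ≤ transMat G w i j := by
  rw [transMat_apply]
  exact add_nonneg (mul_nonneg (by linarith [hw.2]) (metropolis_nonneg G i j))
    (div_nonneg hw.1 (Nat.cast_nonneg N))

lemma sum_transMat (hN : 0 < N) (h_loop : ∀ i, ¬ G.Adj i i) (w : ℝ) (i : Fin N) :
    ∑ j, transMat G w i j = 1 := by
  have hN' : (N : ℝ) ≠ 0 := by exact_mod_cast hN.ne'
  simp only [transMat_apply, Finset.sum_add_distrib, ← Finset.mul_sum, sum_metropolis G h_loop,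
    Finset.sum_const, Finset.card_univ, Fintype.card_fin, nsmul_eq_mul]
  field_simp
  ring

/-- For `w > 0` every entry is positive; for `w = 0` each link carries positive Metropolis–Hastings
weight. -/
lemma transMat_irreducible (hN : 0 < N) (h_loop : ∀ i, ¬ G.Adj i i) {w : ℝ}
    (hw : w ∈ Set.Icc (0 : ℝ) 1) (h_conn : w = 0 → StronglyConnected G) (i j : Fin N) :
    Relation.ReflTransGen (fun a b => 0 < transMat G w a b) i j := by
  rcases hw.1.eq_or_lt with hw0 | hw0
  · by_cases hij : i = j
    · exact hij ▸ Relation.ReflTransGen.refl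
    · refine Relation.ReflTransGen.mono (fun a b hab => ?_) i j
        (h_conn hw0.symm i j hij).to_reflTransGen
      have hne : a ≠ b := fun h => h_loop a (h ▸ hab)
      rw [transMat_apply, ← hw0]
      simpa [metropolis, hne] using linkWeight_pos G hab
  · refine Relation.ReflTransGen.single ?_
    rw [transMat_apply]
    have hN' : (0 : ℝ) < N := by exact_mod_cast hN
    exact add_pos_of_nonneg_of_pos
      (mul_nonneg (by linarith [hw.2]) (metropolis_nonneg G i j)) (div_pos hw0 hN')

end Graph

end PageRank

/-! ### The Markov property along finite paths -/

namespace PageRank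

open MeasureTheory

section Chain

variable {N : ℕ} {Ω : Type*} [MeasurableSpace Ω] {μ : Measure Ω}

lemma integral_comp_fintype {α : Type*} [Fintype α] [MeasurableSpace α]
    [MeasurableSingletonClass α] [IsFiniteMeasure μ] {Y : Ω → α} (hY : Measurable Y) (F : α → ℝ) :
    ∫ a, F (Y a) ∂μ = ∑ c, μ.real (Y ⁻¹' {c}) * F c := by
  rw [← integral_map hY.aemeasurable (measurable_of_finite F).aestronglyMeasurable,
    integral_fintype .of_finite]
  exact Finset.sum_congr rfl fun c _ => by
    rw [map_measureReal_apply hY (measurableSet_singleton c), smul_eq_mul]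

/-- The first `k + 1` entries of a sequence. -/
def initSegment {α : Type*} (k : ℕ) (σ : ℕ → α) : Fin (k + 1) → α := fun t => σ t

/-- The sequence that continues a finite one by repeating its last entry. -/
def extend {α : Type*} (k : ℕ) (c : Fin (k + 1) → α) : ℕ → α :=
  fun t => c ⟨min t k, by omega⟩

lemma extend_initSegment {α : Type*} (k : ℕ) (σ : ℕ → α) {t : ℕ} (ht : t ≤ k) :
    extend k (initSegment k σ) t = σ t := by
  simp [extend, initSegment, min_eq_left ht]

lemma initSegment_eq_iff {α : Type*} (k : ℕ) (σ : ℕ → α) (c : Fin (k + 1) → α) :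
    initSegment k σ = c ↔ ∀ t ≤ k, σ t = extend k c t := by
  constructor
  · rintro rfl t ht
    exact (extend_initSegment k σ ht).symm
  · intro h
    funext t
    have ht : (t : ℕ) ≤ k := Nat.lt_succ_iff.mp t.2
    have := h t ht
    simpa [extend, initSegment, min_eq_left ht] using this

variable {P : Matrix (Fin N) (Fin N) ℝ} {s : ℕ → Ω → Fin N}

lemma IsMarkovChain.measurable_initSegment (hs : IsMarkovChain μ P s) (k : ℕ) :
    Measurable fun a => initSegment k fun t => s t a :=
  measurable_pi_lambda _ fun t => hs.measurable t

/-- A function of a path that only depends on its entries up to time `k` is measurable along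
the chain. -/
lemma IsMarkovChain.measurable_comp (hs : IsMarkovChain μ P s) (k : ℕ) {β : Type*}
    [MeasurableSpace β] (F : (ℕ → Fin N) → β)
    (hF : ∀ σ τ, (∀ t ≤ k, σ t = τ t) → F σ = F τ) : Measurable fun a => F fun t => s t a := by
  have : (fun a => F fun t => s t a) =
      (fun c => F (extend k c)) ∘ fun a => initSegment k fun t => s t a :=
    funext fun a => hF _ _ fun t ht => (extend_initSegment k (fun t => s t a) ht).symm
  rw [this]
  exact (measurable_of_finite _).comp (hs.measurable_initSegment k)

lemma IsMarkovChain.integrable_comp [IsFiniteMeasure μ] (hs : IsMarkovChain μ P s) (k : ℕ)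
    (F : (ℕ → Fin N) → ℝ) (hF : ∀ σ τ, (∀ t ≤ k, σ t = τ t) → F σ = F τ) :
    Integrable (fun a => F fun t => s t a) μ := by
  have : (fun a => F fun t => s t a) =
      (fun c => F (extend k c)) ∘ fun a => initSegment k fun t => s t a :=
    funext fun a => hF _ _ fun t ht => (extend_initSegment k (fun t => s t a) ht).symm
  rw [this]
  exact (Integrable.of_finite (μ := μ.map _)).comp_measurable (hs.measurable_initSegment k)

/-- The Markov property, integrated against functions of the past and the next state. -/
lemma IsMarkovChain.integral_succ [IsFiniteMeasure μ] (hs : IsMarkovChain μ P s) (k : ℕ)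
    (g : (ℕ → Fin N) → Fin N → ℝ) (hg : ∀ σ τ, (∀ t ≤ k, σ t = τ t) → g σ = g τ) :
    ∫ a, g (fun t => s t a) (s (k + 1) a) ∂μ =
      ∫ a, ∑ j, P (s k a) j * g (fun t => s t a) j ∂μ := by
  have hY := hs.measurable_initSegment k
  have hext : ∀ a, g (fun t => s t a) = g (extend k (initSegment k fun t => s t a)) := fun a =>
    hg _ _ fun t ht => (extend_initSegment k (fun t => s t a) ht).symm
  have hlast : ∀ a, s k a = extend k (initSegment k fun t => s t a) k := fun a =>
    (extend_initSegment k (fun t => s t a) le_rfl).symm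
  have hprob : ∀ c j, μ.real ((fun a => (initSegment k fun t => s t a, s (k + 1) a)) ⁻¹' {(c, j)}) =
      μ.real ((fun a => initSegment k fun t => s t a) ⁻¹' {c}) * P (extend k c k) j := fun c j => by
    -- The path `c` followed by `j`, encoded as an infinite sequence; entries after time `k + 1`
    -- play no role.
    have key := hs.transition k (Function.update (extend k c) (k + 1) j)
    have hne : ∀ t ≤ k, Function.update (extend k c) (k + 1) j t = extend k c t := fun t ht =>
      Function.update_of_ne (by omega) _ _
    rw [hne k le_rfl, Function.update_self] at key
    convert key using 2
    · ext a
      simp only [Set.mem_preimage, Set.mem_singleton_iff, Prod.mk.injEq, initSegment_eq_iff,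
        Set.mem_ofPred_eq]
      constructor
      · rintro ⟨h1, h2⟩ t ht
        rcases Nat.lt_or_ge k t with hlt | hle
        · obtain rfl : t = k + 1 := by omega
          rw [Function.update_self, h2]
        · rw [hne t hle, h1 t hle]
      · intro h
        refine ⟨fun t ht => by rw [h t (by omega), hne t ht], ?_⟩
        rw [h _ le_rfl, Function.update_self]
    · congr 1
      ext a
      simp only [Set.mem_preimage, Set.mem_singleton_iff, initSegment_eq_iff, Set.mem_ofPred_eq]
      exact forall₂_congr fun t ht => by rw [hne t ht]
  calc ∫ a, g (fun t => s t a) (s (k + 1) a) ∂μ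
      = ∫ a, (fun z : (Fin (k + 1) → Fin N) × Fin N => g (extend k z.1) z.2)
          (initSegment k fun t => s t a, s (k + 1) a) ∂μ := by simp only [hext]
    _ = ∑ c, ∑ j, μ.real ((fun a => initSegment k fun t => s t a) ⁻¹' {c}) * P (extend k c k) j *
          g (extend k c) j := by
        refine (integral_comp_fintype (μ := μ) (hY.prodMk (hs.measurable (k + 1)))
          (fun z => g (extend k z.1) z.2)).trans ?_
        rw [Fintype.sum_prod_type]
        simp only [hprob]
    _ = ∑ c, μ.real ((fun a => initSegment k fun t => s t a) ⁻¹' {c}) *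
          ∑ j, P (extend k c k) j * g (extend k c) j := by
        simp only [Finset.mul_sum, mul_assoc]
    _ = ∫ a, (fun c => ∑ j, P (extend k c k) j * g (extend k c) j)
          (initSegment k fun t => s t a) ∂μ := (integral_comp_fintype hY _).symm
    _ = _ := by simp only [← hext, ← hlast]

end Chain

/-! ### The mean square error as an averaged energy -/

section Iterates

variable {N : ℕ} (G : Digraph (Fin N)) [DecidableRel G.Adj] {m : ℝ} {x : Fin N → ℝ}

lemma iter_succ_sub (hx : ∀ i, regRow G m i ⬝ᵥ x = m / N) (σ : ℕ → Fin N) (k : ℕ) :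
    iter G m σ (k + 1) - x = errorStep (regRow G m (σ k)) (iter G m σ k - x) := by
  simp only [iter, errorStep, dotProduct_sub, hx]
  module

lemma iter_congr {σ τ : ℕ → Fin N} {k : ℕ} (h : ∀ t < k, σ t = τ t) :
    iter G m σ k = iter G m τ k := by
  induction k with
  | zero => rfl
  | succ k ih =>
    simp only [iter, ih fun t ht => h t (by omega), h k k.lt_succ_self]

variable {Ω : Type*} [MeasurableSpace Ω] {μ : Measure Ω} {P : Matrix (Fin N) (Fin N) ℝ}
  {s : ℕ → Ω → Fin N}

/-- Each use of the Markov property trades one elapsed step for one step of energy, keeping `n + k`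
constant, until time `0`, where the error is `-x`. -/
lemma integral_energy_iter [IsFiniteMeasure μ] (hs : IsMarkovChain μ P s)
    (hx : ∀ i, regRow G m i ⬝ᵥ x = m / N) (n k : ℕ) :
    ∫ a, energy P (regRow G m) n (s k a) (iter G m (fun t => s t a) k - x) ∂μ =
      ∫ a, energy P (regRow G m) (n + k) (s 0 a) (-x) ∂μ := by
  induction k generalizing n with
  | zero => simp [iter]
  | succ k ih =>
    -- The iterate at time `k + 1` depends only on states up to time `k`, so it belongs to the past
    -- when `s (k + 1)` is averaged out.
    rw [hs.integral_succ k
      (fun σ j => energy P (regRow G m) n j (iter G m σ (k + 1) - x))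
      fun σ τ h => by simp only [iter_congr G fun t ht => h t (Nat.lt_succ_iff.mp ht)],
      ← Nat.add_assoc, Nat.add_right_comm, ← ih (n + 1)]
    simp only [energy, iter_succ_sub G hx]

/-- The mean square error decays exponentially as soon as the energies do. -/
lemma integral_iter_sub_le [IsProbabilityMeasure μ] (hs : IsMarkovChain μ P s)
    (hx : ∀ i, regRow G m i ⬝ᵥ x = m / N) {k : ℕ} {b : ℝ}
    (hb : ∀ i v, energy P (regRow G m) k i v ≤ b * (v ⬝ᵥ v)) :
    ∫ a, (iter G m (fun t => s t a) k - x) ⬝ᵥ (iter G m (fun t => s t a) k - x) ∂μ ≤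
      b * (x ⬝ᵥ x) := by
  have h := integral_energy_iter G hs hx 0 k
  simp only [zero_add] at h
  refine h.le.trans ?_
  calc ∫ a, energy P (regRow G m) k (s 0 a) (-x) ∂μ ≤ ∫ _, b * (x ⬝ᵥ x) ∂μ := by
        refine integral_mono
          (hs.integrable_comp 0 (fun σ => energy P (regRow G m) k (σ 0) (-x))
            fun σ τ h => by rw [h 0 le_rfl]) (integrable_const _) fun a => ?_
        simpa using hb (s 0 a) (-x)
    _ = b * (x ⬝ᵥ x) := by simp

end Iterates

/-! ### From mean square decay to almost sure and `L^p` decay -/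

section Decay

variable {Ω : Type*} [MeasurableSpace Ω] {μ : Measure Ω}

/-- Exponential decay in mean square implies eventual exponential decay almost surely. -/
lemma exists_ae_eventually_le_pow [IsFiniteMeasure μ] {f : ℕ → Ω → ℝ}
    (hf : ∀ k, Integrable (fun a => f k a ^ 2) μ) {C r : ℝ}
    (hr : r ∈ Set.Ioo (0 : ℝ) 1) (hC : ∀ k, ∫ a, f k a ^ 2 ∂μ ≤ C * r ^ k) :
    ∃ ρ ∈ Set.Ioo (0 : ℝ) 1, ∀ᵐ a ∂μ, ∀ᶠ k in Filter.atTop, f k a ≤ ρ ^ k := by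
  have hq0 : 0 < √r := Real.sqrt_pos.mpr hr.1
  have hq1 : √r < 1 := (Real.sqrt_lt' one_pos).mpr (by simpa using hr.2)
  have hq : √r ^ 2 = r := Real.sq_sqrt hr.1.le
  have hρ0 : 0 < √√r := Real.sqrt_pos.mpr hq0
  have hρ1 : √√r < 1 := (Real.sqrt_lt' one_pos).mpr (by simpa using hq1)
  have hρ : √√r ^ 2 = √r := Real.sq_sqrt hq0.le
  refine ⟨√√r, ⟨hρ0, hρ1⟩, ?_⟩
  -- Chebyshev at threshold `√r ^ k` splits `r ^ k` evenly, leaving a summable bound for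
  -- Borel–Cantelli. A threshold on `f²` bounds `f` by its root, hence the rate `√√r`.
  have hmeas : ∀ k, μ {a | √r ^ k ≤ f k a ^ 2} ≤ ENNReal.ofReal (C * √r ^ k) := fun k => by
    rw [← ofReal_measureReal]
    refine ENNReal.ofReal_le_ofReal ?_
    have h := (mul_meas_ge_le_integral_of_nonneg (.of_forall fun a => sq_nonneg (f k a)) (hf k)
      (√r ^ k)).trans (hC k)
    have hpow : C * r ^ k = √r ^ k * (C * √r ^ k) := by
      rw [← hq, ← pow_mul, two_mul, pow_add]
      simp only [hq]
      ring
    rw [hpow] at h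
    exact le_of_mul_le_mul_left h (pow_pos hq0 k)
  have hsum : ∑' k, μ {a | √r ^ k ≤ f k a ^ 2} ≠ ∞ :=
    ne_top_of_le_ne_top
      ((summable_geometric_of_lt_one hq0.le hq1).mul_left C).tsum_ofReal_ne_top
      (ENNReal.tsum_le_tsum hmeas)
  filter_upwards [ae_eventually_notMem hsum] with a ha
  filter_upwards [ha] with k hk
  rw [not_le, ← hρ, ← pow_mul, mul_comm, pow_mul] at hk
  exact (lt_of_pow_lt_pow_left₀ 2 (by positivity) hk).le

lemma eLpNorm_two_le_of_integral_sq_le {f : Ω → ℝ} (hfm : AEStronglyMeasurable f μ)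
    (hf : Integrable (fun a => f a ^ 2) μ) {b : ℝ} (hb : ∫ a, f a ^ 2 ∂μ ≤ b) :
    eLpNorm f 2 μ ≤ ENNReal.ofReal √b := by
  rw [((memLp_two_iff_integrable_sq hfm).mpr hf).eLpNorm_eq_integral_rpow_norm two_ne_zero
    ENNReal.ofNat_ne_top]
  refine ENNReal.ofReal_le_ofReal ?_
  rw [Real.sqrt_eq_rpow, one_div]
  simp only [ENNReal.toReal_ofNat, Real.rpow_ofNat, Real.norm_eq_abs, sq_abs]
  exact Real.rpow_le_rpow (integral_nonneg fun a => sq_nonneg _) hb (by norm_num)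

/-- The comparison passes through the sup norm. The `+ 1` keeps `K` positive even for `N = 0`. -/
lemma exists_norm_toLp_le {N : ℕ} (p : ℝ≥0∞) (hp : 1 ≤ p) :
    ∃ K > (0 : ℝ), ∀ v : Fin N → ℝ, ‖(WithLp.toLp p v : PiLp p fun _ : Fin N => ℝ)‖ ≤
      K * ‖(WithLp.toLp 2 v : EuclideanSpace ℝ (Fin N))‖ := by
  have : Fact (1 ≤ p) := ⟨hp⟩
  refine ⟨(((Fintype.card (Fin N) : NNReal) ^ (1 / p).toReal : NNReal) : ℝ) + 1, by positivity,
    fun v => ?_⟩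
  have h1 := (PiLp.antilipschitzWith_ofLp p fun _ : Fin N => ℝ).le_mul_norm_sub 0
    (WithLp.toLp p v)
  simp only [neg_zero, zero_add, WithLp.ofLp_zero] at h1
  have h2 : ‖v‖ ≤ ‖(WithLp.toLp 2 v : EuclideanSpace ℝ (Fin N))‖ :=
    (pi_norm_le_iff_of_nonneg (norm_nonneg _)).mpr fun i =>
      PiLp.norm_apply_le (WithLp.toLp 2 v : EuclideanSpace ℝ (Fin N)) i
  refine h1.trans (mul_le_mul (by linarith) h2 (norm_nonneg _) (by positivity))

lemma norm_toLp_two_sq {N : ℕ} (v : Fin N → ℝ) :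
    ‖(WithLp.toLp 2 v : EuclideanSpace ℝ (Fin N))‖ ^ 2 = v ⬝ᵥ v := by
  rw [EuclideanSpace.real_norm_sq_eq]
  exact Finset.sum_congr rfl fun i _ => sq _

end Decay

end PageRank

/-! ### The convergence theorem -/

theorem theorem1 {N : ℕ} (G : Digraph (Fin N)) [DecidableRel G.Adj]
    (h_loop : ∀ i, ¬ G.Adj i i) (h_dangling : ∀ i, ∃ j, G.Adj i j)
    (m : ℝ) (hm : m ∈ Set.Ioo (0 : ℝ) 1) (w : ℝ) (hw : w ∈ Set.Icc (0 : ℝ) 1)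
    (h_conn : w = 0 → PageRank.StronglyConnected G)
    {Ω : Type*} [MeasurableSpace Ω] (μ : MeasureTheory.Measure Ω)
    [MeasureTheory.IsProbabilityMeasure μ] (s : ℕ → Ω → Fin N)
    (hs : PageRank.IsMarkovChain μ (PageRank.transMat G w) s) :
    (∃! x : Fin N → ℝ, PageRank.IsPageRank G m x) ∧
    ∀ x : Fin N → ℝ, PageRank.IsPageRank G m x →
      (∃ M₁ > (0 : ℝ), ∃ ρ₁ ∈ Set.Ioo (0 : ℝ) 1, ∀ᵐ a ∂μ, ∃ k₀ : ℕ, 0 < k₀ ∧ ∀ k > k₀,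
        ‖(WithLp.toLp 2 (PageRank.iter G m (fun t => s t a) k - x) :
          EuclideanSpace ℝ (Fin N))‖ ≤ M₁ * ρ₁ ^ k) ∧
      (∀ p : ℝ≥0∞, 1 ≤ p → p ≤ 2 →
        ∃ M₂ > (0 : ℝ), ∃ ρ₂ ∈ Set.Ioo (0 : ℝ) 1, ∀ k : ℕ, 0 < k →
          MeasureTheory.eLpNorm (fun a =>
            ‖(WithLp.toLp p (PageRank.iter G m (fun t => s t a) k - x) :
              PiLp p fun _ : Fin N => ℝ)‖) p μ ≤ ENNReal.ofReal (M₂ * ρ₂ ^ k)) := by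
  have hN : 0 < N := by
    obtain ⟨a⟩ := MeasureTheory.nonempty_of_isProbabilityMeasure μ
    exact (s 0 a).pos
  refine ⟨PageRank.existsUnique_isPageRank G hN h_dangling hm, fun x hx => ?_⟩
  rw [PageRank.isPageRank_iff G hN h_dangling hm] at hx
  obtain ⟨C, hC0, r, hr, hC⟩ := PageRank.exists_energy_le_pow hN
    (PageRank.regRow_dotProduct_self_le G h_loop hm) (PageRank.transMat_nonneg G hw)
    (PageRank.sum_transMat G hN h_loop w) (PageRank.transMat_irreducible G hN h_loop hw h_conn)
    (PageRank.eq_zero_of_regRow_dotProduct_eq_zero G h_dangling hm)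
  set f : ℕ → Ω → ℝ := fun k a => ‖(WithLp.toLp 2 (PageRank.iter G m (fun t => s t a) k - x) :
    EuclideanSpace ℝ (Fin N))‖ with hf
  have hcongr : ∀ k (σ τ : ℕ → Fin N), (∀ t ≤ k, σ t = τ t) →
      PageRank.iter G m σ k = PageRank.iter G m τ k := fun k σ τ h =>
    PageRank.iter_congr G fun t ht => h t ht.le
  have hmeas : ∀ k, Measurable (f k) := fun k =>
    hs.measurable_comp k (fun σ => ‖(WithLp.toLp 2 (PageRank.iter G m σ k - x) :
      EuclideanSpace ℝ (Fin N))‖) fun σ τ h => by simp only [hcongr k σ τ h]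
  have hf_sq : ∀ k, MeasureTheory.Integrable (fun a => f k a ^ 2) μ := fun k =>
    hs.integrable_comp k (fun σ => ‖(WithLp.toLp 2 (PageRank.iter G m σ k - x) :
      EuclideanSpace ℝ (Fin N))‖ ^ 2) fun σ τ h => by simp only [hcongr k σ τ h]
  -- The `+ 1` makes the constant positive without having to show `x ≠ 0`.
  have hdecay : ∀ k, ∫ a, f k a ^ 2 ∂μ ≤ (C * (x ⬝ᵥ x) + 1) * r ^ k := fun k => by
    simp only [hf, PageRank.norm_toLp_two_sq]
    refine (PageRank.integral_iter_sub_le G hs hx (hC k)).trans ?_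
    nlinarith [pow_pos hr.1 k]
  have hx0 : 0 ≤ x ⬝ᵥ x := Finset.sum_nonneg fun i _ => mul_self_nonneg _
  have hA0 : 0 < C * (x ⬝ᵥ x) + 1 := by positivity
  generalize C * (x ⬝ᵥ x) + 1 = A at hdecay hA0
  constructor
  · obtain ⟨ρ, hρ, hae⟩ := PageRank.exists_ae_eventually_le_pow hf_sq hr hdecay
    refine ⟨1, one_pos, ρ, hρ, ?_⟩
    filter_upwards [hae] with a ha
    obtain ⟨k₀, hk₀⟩ := Filter.eventually_atTop.mp ha
    refine ⟨k₀ + 1, k₀.succ_pos, fun k hk => ?_⟩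
    rw [one_mul]
    exact hk₀ k (by omega)
  · intro p hp1 hp2
    obtain ⟨K, hK0, hK⟩ := PageRank.exists_norm_toLp_le (N := N) p hp1
    -- `K` compares the vector norms pointwise, `L^p ≤ L²` holds on a probability space for `p ≤ 2`,
    -- and square roots come from the mean square bound `A * r ^ k`.
    refine ⟨K * √A, mul_pos hK0 (Real.sqrt_pos.mpr hA0), √r, ⟨Real.sqrt_pos.mpr hr.1,
      (Real.sqrt_lt' one_pos).mpr (by simpa using hr.2)⟩, fun k _ => ?_⟩
    calc MeasureTheory.eLpNorm (fun a =>
            ‖(WithLp.toLp p (PageRank.iter G m (fun t => s t a) k - x) :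
              PiLp p fun _ : Fin N => ℝ)‖) p μ
        ≤ ENNReal.ofReal K * MeasureTheory.eLpNorm (f k) p μ := by
          have : Fact (1 ≤ p) := ⟨hp1⟩
          refine MeasureTheory.eLpNorm_le_mul_eLpNorm_of_ae_le_mul (.of_forall fun a => ?_) p
          simp only [hf, Real.norm_eq_abs, abs_norm]
          exact hK _
      _ ≤ ENNReal.ofReal K * MeasureTheory.eLpNorm (f k) 2 μ := by
          gcongr
          exact MeasureTheory.eLpNorm_le_eLpNorm_of_exponent_le hp2
            (hmeas k).aestronglyMeasurable
      _ ≤ ENNReal.ofReal K * ENNReal.ofReal √(A * r ^ k) := by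
          gcongr
          exact PageRank.eLpNorm_two_le_of_integral_sq_le (hmeas k).aestronglyMeasurable (hf_sq k)
            (hdecay k)
      _ = ENNReal.ofReal (K * √A * √r ^ k) := by
          rw [← ENNReal.ofReal_mul hK0.le, Real.sqrt_mul hA0.le, mul_assoc]
          congr 3
          rw [Real.sqrt_eq_iff_mul_self_eq (pow_nonneg hr.1.le k) (by positivity), ← mul_pow,
            Real.mul_self_sqrt hr.1.le]
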